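/- Let $\mathcal R=(\mathbb R,<,+,\ldots)$ be a first-order structure expanding the ordered additive group of real numbers; "definable" means definable in $\mathcal R$, possibly with parameters. An $\omega$-orderable set is a definable set that is either finite or admits a definable ordering of order type $\omega$; an $\omega$-orderable set $D\subseteq\mathbb R$ is called dense if it is dense in some nonempty open interval of $\mathbb R$. The expansion $\mathcal R$ is of type B if it defines a dense $\omega$-orderable set but there are a $k$ and a compact subset of $\mathbb R^k$ that is not definable in $\mathcal R$. A weak pole is a definable family $\{h_d : d\in E\}$ of continuous maps $h_d:[0,d]\to\mathbb R$ such that (i) $E\subseteq\mathbb R_{>0}$ is closed in $\mathbb R_{>0}$, and $(0,\epsilon)\cap E\neq\emptyset$ for all $\epsilon>0$; (ii) there is a $\delta>0$ such that $[0,\delta]\subseteq h_d([0,d])$ for all $d\in E$. Theorem. If $\mathcal R$ is of type B, then $\mathcal R$ does not define a weak pole. -/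

import Mathlib

open scoped FirstOrder

universe u v

namespace WeakPoles

/-- The function symbols of the language `{<, +}`: one binary symbol. -/
inductive OrdAddFunc : ℕ → Type
  | add : OrdAddFunc 2

/-- The relation symbols of the language `{<, +}`: one binary symbol. -/
inductive OrdAddRel : ℕ → Type
  | lt : OrdAddRel 2

/-- The language `{<, +}` of ordered additive groups. -/
def ordAdd : FirstOrder.Language.{0, 0} := ⟨OrdAddFunc, OrdAddRel⟩

/-- The ordered additive group of real numbers `(ℝ, <, +)`. -/
instance ordAddStructureReal : ordAdd.Structure ℝ where
  funMap {_} f := match f with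
    | OrdAddFunc.add => fun x => x 0 + x 1
  RelMap {_} r := match r with
    | OrdAddRel.lt => fun x => x 0 < x 1

section

variable (L : FirstOrder.Language.{u, v}) [L.Structure ℝ]

/-- `X ⊆ ℝⁿ` is definable in the `L`-structure on `ℝ`, with arbitrary real parameters. -/
def Def {n : ℕ} (X : Set (Fin n → ℝ)) : Prop :=
  (Set.univ : Set ℝ).Definable L X

/-- `D ⊆ ℝ` is `ω`-orderable: it is definable, and it is finite or carries a definable (strict)
ordering of order type `ω`. -/
def IsOmegaOrderable (D : Set ℝ) : Prop :=
  Def L {v : Fin 1 → ℝ | v 0 ∈ D} ∧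
    (D.Finite ∨
      ∃ r : ℝ → ℝ → Prop,
        Def L {v : Fin 2 → ℝ | v 0 ∈ D ∧ v 1 ∈ D ∧ r (v 0) (v 1)} ∧
          Nonempty (Subrel r (· ∈ D) ≃r ((· < ·) : ℕ → ℕ → Prop)))

/-- The structure defines an `ω`-orderable set that is dense in some nonempty bounded open
interval. -/
def DefinesDenseOmegaOrderable : Prop :=
  ∃ D : Set ℝ, IsOmegaOrderable L D ∧ ∃ a b : ℝ, a < b ∧ Set.Ioo a b ⊆ closure D

/-- Type B: the structure defines a dense `ω`-orderable set, but there is a compact subset of some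
`ℝᵏ` that it does not define. -/
def IsTypeB : Prop :=
  DefinesDenseOmegaOrderable L ∧
    ∃ (k : ℕ) (K : Set (Fin k → ℝ)), IsCompact K ∧ ¬ Def L K

/-- The family `{h d : d ∈ E}` of maps `h d : [0, d] → ℝ` is a weak pole of the structure.
Only the values `h d t` with `d ∈ E` and `0 ≤ t ≤ d` are relevant. Definability of the family is
definability of the set of triples `(d, t, h d t)`; its projection `E` is then definable too. -/
structure IsWeakPole (E : Set ℝ) (h : ℝ → ℝ → ℝ) : Prop where
  definable : Def L {v : Fin 3 → ℝ | v 0 ∈ E ∧ v 1 ∈ Set.Icc 0 (v 0) ∧ v 2 = h (v 0) (v 1)}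
  continuousOn : ∀ d ∈ E, ContinuousOn (h d) (Set.Icc 0 d)
  pos : E ⊆ Set.Ioi 0
  /-- `E` is closed in the subspace `ℝ_{>0}`. -/
  closed : IsClosed {x : Set.Ioi (0 : ℝ) | (x : ℝ) ∈ E}
  accumulates : ∀ ε : ℝ, 0 < ε → (Set.Ioo 0 ε ∩ E).Nonempty
  image : ∃ δ : ℝ, 0 < δ ∧ ∀ d ∈ E, Set.Icc 0 δ ⊆ h d '' Set.Icc 0 d

/-- The structure defines (admits) a weak pole. -/
def DefinesWeakPole : Prop :=
  ∃ (E : Set ℝ) (h : ℝ → ℝ → ℝ), IsWeakPole L E h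

end

end WeakPoles

/-!
Given a dense `ω`-orderable set and a weak pole `{h d : d ∈ E}`, every compact subset of every `ℝᵏ`
is definable, which contradicts type B.

Let `u 0, u 1, …` enumerate the `ω`-orderable set along its definable order, and let it be dense in
`(a, b)`. To each `u n` belongs a definable scale `d n ∈ E`, the largest element of `E ∩ (0, 1]` not
exceeding any gap between `u 0, …, u n`; the scales tend to `0`. Infinitely many pieces of
information are stored in finitely many reals as follows.

* A real `c₀` marks its left records: the `u n > a` that are the best approximations to `c₀` from
  the left among `u 0, …, u n`.
* A real `c` assigns to a marked `u n` the value `h (d n) (c - u m)`, where `m ≤ n` and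
  `u m < c < u m + d n`. By the choice of the scale, `m` is unique.

Since `h (d n)` is continuous and maps the tiny interval `[0, d n]` onto a set containing a fixed
`[0, δ]`, a nested interval construction (`Stage.exists_refines`, `exists_code`) shows that any
sequence of target intervals in `(0, δ)` is met by the values of suitable reals at the successive
marked terms. An open subset of `(0, δ)^k` is a countable union of boxes whose corners matter only
up to a small error (`exists_approximate_boxes`), so it is coded by one marking real and `2k` value
reals (`exists_codedOpen_eq`), and is definable with these as parameters. Complements give the
compact subsets of `(0, δ)^k`, and translation and doubling give all others (`def_of_isCompact`).
-/

namespace WeakPoles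

open FirstOrder FirstOrder.Language Set Filter Topology

/-! ### Definable predicates -/

section Definability

variable (L : FirstOrder.Language.{u, v}) [L.Structure ℝ] {α : Type}

/-- A predicate on tuples of reals is definable, with arbitrary real parameters. -/
def DefinablePred (P : (α → ℝ) → Prop) : Prop :=
  (univ : Set ℝ).Definable L {v : α → ℝ | P v}

/-- A real function of tuples of reals is definable, with arbitrary real parameters. -/
abbrev DefinableFn (f : (α → ℝ) → ℝ) : Prop :=
  (univ : Set ℝ).DefinableFun L f

variable {L}

namespace DefinablePred

variable {P Q : (α → ℝ) → Prop}

theorem and (hP : DefinablePred L P) (hQ : DefinablePred L Q) :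
    DefinablePred L fun v => P v ∧ Q v :=
  Definable.inter hP hQ

theorem not (hP : DefinablePred L P) : DefinablePred L fun v => ¬ P v :=
  Definable.compl hP

theorem imp (hP : DefinablePred L P) (hQ : DefinablePred L Q) :
    DefinablePred L fun v => P v → Q v := by
  have := (hP.and hQ.not).not
  simpa only [not_and, not_not] using this

theorem ex {P : (α → ℝ) → ℝ → Prop}
    (h : DefinablePred L fun w : Option α → ℝ => P (fun i => w (some i)) (w none)) :
    DefinablePred L fun v => ∃ t, P v t := by
  have h' : (univ : Set ℝ).Definable L
      {w : α ⊕ Unit → ℝ | P (fun i => w (Sum.inl i)) (w (Sum.inr ()))} :=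
    Definable.preimage_comp (α := Option α) (β := α ⊕ Unit)
      (fun o => o.elim (Sum.inr ()) Sum.inl) h
  refine (congrArg _ ?_).mpr h'.exists_of_finite
  ext v
  exact ⟨fun ⟨t, ht⟩ => ⟨fun _ => t, ht⟩, fun ⟨w, hw⟩ => ⟨w (), hw⟩⟩

theorem all {P : (α → ℝ) → ℝ → Prop}
    (h : DefinablePred L fun w : Option α → ℝ => P (fun i => w (some i)) (w none)) :
    DefinablePred L fun v => ∀ t, P v t := by
  have := (ex (P := fun v t => ¬ P v t) h.not).not
  simpa only [not_exists, not_not] using this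

theorem forall_of_finite {ι : Type} [Finite ι] {P : ι → (α → ℝ) → Prop}
    (h : ∀ i, DefinablePred L (P i)) : DefinablePred L fun v => ∀ i, P i v := by
  have := definable_iInter_of_finite h
  rwa [← ofPred_forall] at this

theorem comp {β : Type} [Finite β] {P : (β → ℝ) → Prop} (hP : DefinablePred L P)
    {F : (α → ℝ) → β → ℝ} (hF : ∀ i, DefinableFn L fun v => F v i) :
    DefinablePred L fun v => P (F v) :=
  Definable.preimage_map (F := F) hF hP

theorem comp₁ {R : ℝ → Prop} (hR : DefinablePred L fun v : Fin 1 → ℝ => R (v 0))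
    {f : (α → ℝ) → ℝ} (hf : DefinableFn L f) : DefinablePred L fun v => R (f v) :=
  hR.comp (F := fun v => ![f v]) (fun i => by fin_cases i; exact hf)

theorem comp₂ {R : ℝ → ℝ → Prop} (hR : DefinablePred L fun v : Fin 2 → ℝ => R (v 0) (v 1))
    {f g : (α → ℝ) → ℝ} (hf : DefinableFn L f) (hg : DefinableFn L g) :
    DefinablePred L fun v => R (f v) (g v) :=
  hR.comp (F := fun v => ![f v, g v]) (fun i => by fin_cases i <;> assumption)

theorem comp₃ {R : ℝ → ℝ → ℝ → Prop}
    (hR : DefinablePred L fun v : Fin 3 → ℝ => R (v 0) (v 1) (v 2))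
    {f g h : (α → ℝ) → ℝ} (hf : DefinableFn L f) (hg : DefinableFn L g)
    (hh : DefinableFn L h) : DefinablePred L fun v => R (f v) (g v) (h v) :=
  hR.comp (F := fun v => ![f v, g v, h v]) (fun i => by fin_cases i <;> assumption)

theorem eq {f g : (α → ℝ) → ℝ} (hf : DefinableFn L f) (hg : DefinableFn L g) :
    DefinablePred L fun v => f v = g v :=
  hf.ofPred_eq hg

end DefinablePred

theorem definableFn_const (a : ℝ) : DefinableFn L fun _ : α → ℝ => a :=
  L.definableFun_const α (mem_univ a)

theorem definableFn_proj (i : α) : DefinableFn L fun v : α → ℝ => v i :=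
  DefinableFun.proj L

theorem DefinablePred.lt (φ : ordAdd →ᴸ L) [φ.IsExpansionOn ℝ] {f g : (α → ℝ) → ℝ}
    (hf : DefinableFn L f) (hg : DefinableFn L g) :
    DefinablePred L fun v => f v < g v := by
  refine DefinablePred.comp₂ (R := (· < ·)) ?_ hf hg
  have h : (∅ : Set ℝ).Definable ordAdd {v : Fin 2 → ℝ | v 0 < v 1} := by
    rw [empty_definable_iff]
    exact ⟨Relations.formula (L := ordAdd) (n := 2) OrdAddRel.lt Term.var, by
      ext v; simp; rfl⟩
  exact (h.map_expansion φ).mono (empty_subset _)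

theorem DefinablePred.le (φ : ordAdd →ᴸ L) [φ.IsExpansionOn ℝ] {f g : (α → ℝ) → ℝ}
    (hf : DefinableFn L f) (hg : DefinableFn L g) :
    DefinablePred L fun v => f v ≤ g v := by
  simpa only [not_lt] using (DefinablePred.lt φ hg hf).not

theorem definableFn_add (φ : ordAdd →ᴸ L) [φ.IsExpansionOn ℝ] {f g : (α → ℝ) → ℝ}
    (hf : DefinableFn L f) (hg : DefinableFn L g) :
    DefinableFn L fun v => f v + g v := by
  have h : (∅ : Set ℝ).DefinableFun ordAdd fun v : Fin 2 → ℝ => v 0 + v 1 :=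
    DefinableFun.fun_symbol (L := ordAdd) (n := 2) OrdAddFunc.add
  have h' : DefinableFn L fun v : Fin 2 → ℝ => v 0 + v 1 :=
    (h.map_expansion φ).mono (empty_subset _)
  exact h'.comp (g := fun v => ![f v, g v]) (fun i => by fin_cases i <;> assumption)

end Definability

/-! ### Coding by left records and scales -/

section Coding

/-- `x` precedes or equals `y` in the enumeration `u 0, u 1, …`; this is the order of type `ω`
on the range of an injective `u`. -/
def Precedes (u : ℕ → ℝ) (x y : ℝ) : Prop :=
  ∃ m n, m ≤ n ∧ u m = x ∧ u n = y

/-- `e > a` is a left record of `c`: it is the best approximation to `c` from the left among the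
terms of the enumeration up to `e`. -/
def IsLeftRecord (u : ℕ → ℝ) (a c e : ℝ) : Prop :=
  Precedes u e e ∧ a < e ∧ e < c ∧ ¬ ∃ x, Precedes u x e ∧ e < x ∧ x < c

/-- Distinct terms of the enumeration up to `e` are at least `d` apart. -/
def IsSeparation (u : ℕ → ℝ) (e d : ℝ) : Prop :=
  ∀ x y, Precedes u x e → Precedes u y e → x < y → x + d ≤ y

/-- `d` is the largest element of `E ∩ (-∞, 1]` that separates the terms of the enumeration up
to `e`. The bound `1` ensures that a largest one exists even
where there is nothing to separate. -/
def IsScale (u : ℕ → ℝ) (E : Set ℝ) (e d : ℝ) : Prop :=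
  (d ∈ E ∧ d ≤ 1 ∧ IsSeparation u e d) ∧
    ∀ d', d' ∈ E ∧ d' ≤ 1 ∧ IsSeparation u e d' → d' ≤ d

/-- The graph of the family `h`, as a ternary relation. -/
def FamilyGraph (E : Set ℝ) (h : ℝ → ℝ → ℝ) (d t y : ℝ) : Prop :=
  d ∈ E ∧ t ∈ Icc 0 d ∧ y = h d t

/-- `y` is the value read off from `c` at the scale `d`: the term `x` of the enumeration up to `e`
with `x < c < x + d` is located, and `y = h d (c - x)`. -/
def IsCodedValue (u : ℕ → ℝ) (E : Set ℝ) (h : ℝ → ℝ → ℝ) (c e d y : ℝ) : Prop :=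
  ∃ x t, Precedes u x e ∧ x < c ∧ c < x + d ∧ x + t = c ∧ FamilyGraph E h d t y

section Definability

variable {L : FirstOrder.Language.{u, v}} [L.Structure ℝ]
  {u : ℕ → ℝ} {E : Set ℝ} {h : ℝ → ℝ → ℝ}

theorem definablePred_isLeftRecord (φ : ordAdd →ᴸ L) [φ.IsExpansionOn ℝ]
    (hu : DefinablePred L fun v : Fin 2 → ℝ => Precedes u (v 0) (v 1)) (a c : ℝ) :
    DefinablePred L fun v : Fin 1 → ℝ => IsLeftRecord u a c (v 0) := by
  refine (hu.comp₂ ?_ ?_).and ((DefinablePred.lt φ ?_ ?_).and ((DefinablePred.lt φ ?_ ?_).and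
    (DefinablePred.ex (((hu.comp₂ ?_ ?_).and
      ((DefinablePred.lt φ ?_ ?_).and (DefinablePred.lt φ ?_ ?_))))).not)) <;>
  first | exact definableFn_const _ | exact definableFn_proj _

theorem definablePred_isSeparation (φ : ordAdd →ᴸ L) [φ.IsExpansionOn ℝ]
    (hu : DefinablePred L fun v : Fin 2 → ℝ => Precedes u (v 0) (v 1)) :
    DefinablePred L fun v : Fin 2 → ℝ => IsSeparation u (v 0) (v 1) := by
  refine DefinablePred.all (DefinablePred.all ((hu.comp₂ ?_ ?_).imp ((hu.comp₂ ?_ ?_).imp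
    ((DefinablePred.lt φ ?_ ?_).imp (DefinablePred.le φ (definableFn_add φ ?_ ?_) ?_))))) <;>
  exact definableFn_proj _

theorem definablePred_mem_of_familyGraph (hE : E ⊆ Ioi 0)
    (hh : DefinablePred L fun v : Fin 3 → ℝ => FamilyGraph E h (v 0) (v 1) (v 2)) :
    DefinablePred L fun v : Fin 1 → ℝ => v 0 ∈ E := by
  have key : DefinablePred L fun v : Fin 1 → ℝ => ∃ t y, FamilyGraph E h (v 0) t y := by
    refine DefinablePred.ex (DefinablePred.ex (hh.comp₃ ?_ ?_ ?_)) <;> exact definableFn_proj _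
  have : ∀ d, (∃ t y, FamilyGraph E h d t y) ↔ d ∈ E := fun d =>
    ⟨fun ⟨_, _, hd, _⟩ => hd, fun hd => ⟨0, _, hd, ⟨le_rfl, (hE hd).le⟩, rfl⟩⟩
  simpa only [this] using key

theorem definablePred_isScale (φ : ordAdd →ᴸ L) [φ.IsExpansionOn ℝ]
    (hu : DefinablePred L fun v : Fin 2 → ℝ => Precedes u (v 0) (v 1))
    (hE : DefinablePred L fun v : Fin 1 → ℝ => v 0 ∈ E) :
    DefinablePred L fun v : Fin 2 → ℝ => IsScale u E (v 0) (v 1) := by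
  have hsep := definablePred_isSeparation φ hu
  have hcand : DefinablePred L fun v : Fin 2 → ℝ =>
      v 1 ∈ E ∧ v 1 ≤ 1 ∧ IsSeparation u (v 0) (v 1) := by
    refine (hE.comp₁ (R := fun d => d ∈ E) ?_).and ((DefinablePred.le φ ?_ ?_).and hsep) <;>
    first | exact definableFn_const _ | exact definableFn_proj _
  refine hcand.and (DefinablePred.all ((hcand.comp₂
    (R := fun e d => d ∈ E ∧ d ≤ 1 ∧ IsSeparation u e d) ?_ ?_).imp
      (DefinablePred.le φ ?_ ?_))) <;>
  exact definableFn_proj _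

theorem definablePred_isCodedValue (φ : ordAdd →ᴸ L) [φ.IsExpansionOn ℝ]
    (hu : DefinablePred L fun v : Fin 2 → ℝ => Precedes u (v 0) (v 1))
    (hh : DefinablePred L fun v : Fin 3 → ℝ => FamilyGraph E h (v 0) (v 1) (v 2)) (c : ℝ) :
    DefinablePred L fun v : Fin 3 → ℝ => IsCodedValue u E h c (v 0) (v 1) (v 2) := by
  refine DefinablePred.ex (DefinablePred.ex ((hu.comp₂ ?_ ?_).and ((DefinablePred.lt φ ?_ ?_).and
    ((DefinablePred.lt φ ?_ (definableFn_add φ ?_ ?_)).and ((DefinablePred.eq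
      (definableFn_add φ ?_ ?_) ?_).and (hh.comp₃ ?_ ?_ ?_)))))) <;>
  first | exact definableFn_const _ | exact definableFn_proj _

end Definability

section Enumeration

variable {u : ℕ → ℝ} {E : Set ℝ}

theorem precedes_iff (hu : Function.Injective u) {x : ℝ} {n : ℕ} :
    Precedes u x (u n) ↔ ∃ m ≤ n, u m = x := by
  constructor
  · rintro ⟨m, k, hmk, rfl, hk⟩
    exact ⟨m, hu hk ▸ hmk, rfl⟩
  · rintro ⟨m, hm, rfl⟩
    exact ⟨m, n, hm, rfl, rfl⟩

theorem IsScale.unique {e d d' : ℝ} (h : IsScale u E e d) (h' : IsScale u E e d') : d = d' :=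
  le_antisymm (h'.2 _ h.1) (h.2 _ h'.1)

theorem exists_isSeparation (hu : Function.Injective u) (n : ℕ) :
    ∃ ε > 0, IsSeparation u (u n) ε := by
  classical
  -- The least gap among finitely many positive ones; the element `1` makes the set nonempty.
  let T : Finset ℝ := insert 1 (((Finset.range (n + 1) ×ˢ Finset.range (n + 1)).image
    fun p => u p.2 - u p.1).filter fun t => 0 < t)
  have hT : T.Nonempty := ⟨1, Finset.mem_insert_self _ _⟩
  refine ⟨T.min' hT, ?_, ?_⟩
  · have := T.min'_mem hT
    rcases Finset.mem_insert.1 this with h | h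
    · rw [h]; exact one_pos
    · exact (Finset.mem_filter.1 h).2
  · intro x y hx hy hxy
    obtain ⟨m, hm, rfl⟩ := (precedes_iff hu).1 hx
    obtain ⟨k, hk, rfl⟩ := (precedes_iff hu).1 hy
    have : T.min' hT ≤ u k - u m := by
      refine T.min'_le _ (Finset.mem_insert_of_mem (Finset.mem_filter.2 ⟨Finset.mem_image.2
        ⟨(m, k), ?_, rfl⟩, sub_pos.2 hxy⟩))
      simp only [Finset.mem_product, Finset.mem_range]
      omega
    linarith

/-- Scales exist: the candidates are nonempty because `E` accumulates at `0`, and their supremum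
belongs to `E` because `E` is closed in the positive reals. -/
theorem exists_isScale (hu : Function.Injective u) (hpos : E ⊆ Ioi 0)
    (hclosed : IsClosed {x : Ioi (0 : ℝ) | (x : ℝ) ∈ E})
    (hacc : ∀ ε : ℝ, 0 < ε → (Ioo 0 ε ∩ E).Nonempty) (n : ℕ) :
    ∃ d, IsScale u E (u n) d := by
  obtain ⟨ε, hε, hsep⟩ := exists_isSeparation hu n
  let C : Set ℝ := {d | d ∈ E ∧ d ≤ 1 ∧ IsSeparation u (u n) d}
  obtain ⟨d₀, hd₀, hd₀E⟩ := hacc (min ε 1) (lt_min hε one_pos)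
  have hd₀C : d₀ ∈ C := ⟨hd₀E, hd₀.2.le.trans (min_le_right _ _), fun x y hx hy hxy => by
    have := hsep x y hx hy hxy
    have := hd₀.2.le.trans (min_le_left ε 1)
    linarith⟩
  have hbdd : BddAbove C := ⟨1, fun d hd => hd.2.1⟩
  have hlub := isLUB_csSup ⟨d₀, hd₀C⟩ hbdd
  have hs0 : 0 < sSup C := hd₀.1.trans_le (hlub.1 hd₀C)
  refine ⟨sSup C, ⟨?_, hlub.2 fun d hd => hd.2.1, fun x y hx hy hxy => ?_⟩, fun d hd => hlub.1 hd⟩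
  · obtain ⟨F, hF, hFE⟩ := isClosed_induced_iff.1 hclosed
    have hmem : ∀ x : ℝ, 0 < x → (x ∈ F ↔ x ∈ E) := fun x hx =>
      Set.ext_iff.1 hFE ⟨x, hx⟩
    refine (hmem _ hs0).1 (hF.closure_subset_iff.2 ?_ (hlub.mem_closure ⟨d₀, hd₀C⟩))
    exact fun d hd => (hmem d (hpos hd.1)).2 hd.1
  · have : sSup C ≤ y - x := hlub.2 fun d hd => by
      have := hd.2.2 x y hx hy hxy
      linarith
    linarith

/-- Scales tend to `0`, since the enumeration is dense in an interval. -/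
theorem eventually_scale_lt (hu : Function.Injective u) {a b : ℝ} (hab : a < b)
    (hdense : ∀ x y, a ≤ x → x < y → y ≤ b → ∃ n, u n ∈ Ioo x y) {d : ℕ → ℝ}
    (hd : ∀ n, IsScale u E (u n) (d n)) {ε : ℝ} (hε : 0 < ε) : ∀ᶠ n in atTop, d n < ε := by
  obtain ⟨m, hm⟩ := hdense a (min b (a + ε)) le_rfl (lt_min hab (by linarith)) (min_le_left _ _)
  obtain ⟨k, hk⟩ := hdense a (u m) le_rfl hm.1 (hm.2.le.trans (min_le_left _ _))
  filter_upwards [eventually_ge_atTop (max m k)] with n hn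
  have := (hd n).1.2.2 (u k) (u m) ((precedes_iff hu).2 ⟨k, le_trans (le_max_right _ _) hn, rfl⟩)
    ((precedes_iff hu).2 ⟨m, le_trans (le_max_left _ _) hn, rfl⟩) hk.2
  have := hm.2.trans_le (min_le_right _ _)
  linarith [hk.1]

end Enumeration

/-! ### The nested interval construction -/

theorem exists_between_of_nested {p q : ℕ → ℝ} (hp : ∀ j, p j < p (j + 1))
    (hq : ∀ j, q (j + 1) < q j) (hpq : ∀ j, p j < q j) : ∃ c, ∀ j, p j < c ∧ c < q j := by
  have hpm : StrictMono p := strictMono_nat_of_lt_succ hp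
  have hqm : StrictAnti q := strictAnti_nat_of_succ_lt hq
  have hle : ∀ i j, p i ≤ q j := fun i j =>
    ((hpm.monotone (le_max_left i j)).trans_lt (hpq _)).le.trans
      (hqm.antitone (le_max_right i j))
  have hbdd : BddAbove (range p) := ⟨q 0, by rintro _ ⟨i, rfl⟩; exact hle i 0⟩
  exact ⟨⨆ i, p i, fun j => ⟨(hp j).trans_le (le_ciSup hbdd (j + 1)),
    (ciSup_le fun i => hle i (j + 1)).trans_lt (hq j)⟩⟩

/-- A continuous function on `[0, d]` covering `[0, δ]` takes values in a given subinterval of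
`[0, δ]` on a whole open subinterval of `(0, d)`. -/
theorem exists_interval_mapsTo {g : ℝ → ℝ} {d δ α β : ℝ} (hd : 0 < d)
    (hg : ContinuousOn g (Icc 0 d)) (himg : Icc 0 δ ⊆ g '' Icc 0 d) (hα : 0 ≤ α) (hαβ : α < β)
    (hβ : β ≤ δ) : ∃ l r, 0 < l ∧ l < r ∧ r < d ∧ ∀ t ∈ Ioo l r, g t ∈ Ioo α β := by
  obtain ⟨t₀, ht₀, hgt₀⟩ := himg (show (α + β) / 2 ∈ Icc 0 δ by constructor <;> linarith)
  have hnhds : Ioo α β ∈ 𝓝 (g t₀) := by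
    rw [hgt₀]; exact Ioo_mem_nhds (by linarith) (by linarith)
  obtain ⟨ε, hε, hball⟩ := Metric.mem_nhdsWithin_iff.1 (hg t₀ ht₀ hnhds)
  have hlr : max 0 (t₀ - ε) < min d (t₀ + ε) :=
    max_lt (lt_min hd (by linarith [ht₀.1])) (lt_min (by linarith [ht₀.2]) (by linarith))
  obtain ⟨l, hl, hl'⟩ := exists_between hlr
  obtain ⟨r, hr, hr'⟩ := exists_between hl'
  obtain ⟨hl0, hl1⟩ := max_lt_iff.1 hl
  obtain ⟨hr0, hr1⟩ := lt_min_iff.1 hr'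
  refine ⟨l, r, hl0, hr, hr0, fun t ht => hball ⟨?_, ?_, ?_⟩⟩
  · rw [Metric.mem_ball, Real.dist_eq, abs_lt]
    constructor <;> linarith [ht.1, ht.2]
  · linarith [ht.1]
  · linarith [ht.2]

/-- A stage of the construction: an interval `(p, q)` for the real whose left records are marked,
and intervals `(l i, r i)` for the reals carrying the coded values, all inside `(a, b)`. -/
structure Stage (ι : Type) (a b : ℝ) where
  p : ℝ
  q : ℝ
  l : ι → ℝ
  r : ι → ℝ
  le_p : a ≤ p
  p_lt_q : p < q
  q_le : q ≤ b
  le_l : ∀ i, a ≤ l i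
  l_lt_r : ∀ i, l i < r i
  r_le : ∀ i, r i ≤ b

/-- The stage `s'` refines `s` by marking `u n`, the first term of the enumeration in
`(s.p, s'.q)`, and by forcing the coded values at `u n` into the intervals `(α i, β i)`. -/
structure Stage.Refines {ι : Type} {a b : ℝ} (u d : ℕ → ℝ) (g : ℕ → ℝ → ℝ) (α β : ι → ℝ)
    (n : ℕ) (s s' : Stage ι a b) : Prop where
  p_lt : s.p < s'.p
  q_lt : s'.q < s.q
  p_eq : s'.p = u n
  first : ∀ m < n, u m ∉ Ioo s.p s'.q
  l_lt : ∀ i, s.l i < s'.l i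
  r_lt : ∀ i, s'.r i < s.r i
  value : ∀ i, ∃ m ≤ n, ∀ t ∈ Ioo (s'.l i) (s'.r i),
    u m < t ∧ t < u m + d n ∧ g n (t - u m) ∈ Ioo (α i) (β i)

section Construction

variable {ι : Type} [Finite ι] {a b δ : ℝ} {u d : ℕ → ℝ} {g : ℕ → ℝ → ℝ}

theorem Stage.exists_refines (hdense : ∀ x y, a ≤ x → x < y → y ≤ b → ∃ n, u n ∈ Ioo x y)
    (hd : ∀ n, 0 < d n) (hd0 : ∀ ε > 0, ∀ᶠ n in atTop, d n < ε)
    (hg : ∀ n, ContinuousOn (g n) (Icc 0 (d n))) (himg : ∀ n, Icc 0 δ ⊆ g n '' Icc 0 (d n))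
    {α β : ι → ℝ} (hα : ∀ i, 0 ≤ α i) (hαβ : ∀ i, α i < β i) (hβ : ∀ i, β i ≤ δ)
    (s : Stage ι a b) (j : ℕ) :
    ∃ (s' : Stage ι a b) (n : ℕ), j ≤ n ∧ Stage.Refines u d g α β n s s' := by
  classical
  choose m hm using fun i => hdense (s.l i) (s.r i) (s.le_l i) (s.l_lt_r i) (s.r_le i)
  have hev : ∀ᶠ n in atTop, j ≤ n ∧ ∀ i, m i ≤ n ∧ d n < s.r i - u (m i) :=
    (eventually_ge_atTop j).and (eventually_all.2 fun i =>
      (eventually_ge_atTop (m i)).and (hd0 _ (sub_pos.2 (hm i).2)))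
  obtain ⟨N, hN⟩ := eventually_atTop.1 hev
  -- Shrinking `q` past the finitely many terms with index below `N` makes the first term in
  -- `(p, q')` have index at least `N`.
  obtain ⟨q', hpq', hq'q, hq'⟩ : ∃ q', s.p < q' ∧ q' < s.q ∧ ∀ k < N, u k ∉ Ioo s.p q' := by
    have hfin : ∀ᶠ x in 𝓝[>] s.p, ∀ k ∈ Iio N, u k ∉ Ioo s.p x := by
      refine (eventually_all_finite (finite_Iio N)).2 fun k _ => ?_
      rcases le_or_gt (u k) s.p with hk | hk
      · exact Eventually.of_forall fun x hx => absurd hx.1 hk.not_gt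
      · filter_upwards [Ioo_mem_nhdsGT hk] with x hx hx'
        exact hx'.2.not_gt hx.2
    obtain ⟨q', h1, h2⟩ := (hfin.and (Ioo_mem_nhdsGT s.p_lt_q)).exists
    exact ⟨q', h2.1, h2.2, h1⟩
  have hex := hdense s.p q' s.le_p hpq' (hq'q.le.trans s.q_le)
  have hfind := Nat.find_spec hex
  set n := Nat.find hex
  have hNn : N ≤ n := by
    by_contra! hlt
    exact hq' n hlt hfind
  obtain ⟨hjn, hn⟩ := hN n hNn
  choose l r hl hlr hr hval using fun i =>
    exists_interval_mapsTo (hd n) (hg n) (himg n) (hα i) (hαβ i) (hβ i)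
  refine ⟨{ p := u n, q := q', l := fun i => u (m i) + l i, r := fun i => u (m i) + r i,
            le_p := s.le_p.trans hfind.1.le
            p_lt_q := hfind.2
            q_le := hq'q.le.trans s.q_le
            le_l := fun i => by linarith [s.le_l i, (hm i).1, hl i]
            l_lt_r := fun i => by linarith [hlr i]
            r_le := fun i => by linarith [hr i, (hn i).2, s.r_le i] }, n, hjn,
    { p_lt := hfind.1
      q_lt := hq'q
      p_eq := rfl
      first := fun k hk => Nat.find_min hex hk
      l_lt := fun i => by simp only; linarith [(hm i).1, hl i]
      r_lt := fun i => by simp only; linarith [hr i, (hn i).2]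
      value := fun i => ⟨m i, (hn i).1, fun t ht => ⟨?_, ?_, ?_⟩⟩ }⟩
  · linarith [ht.1, hl i]
  · linarith [ht.2, hr i]
  · exact hval i _ ⟨by linarith [ht.1], by linarith [ht.2]⟩

/-- Every sequence of target intervals is realized: some real has left records exactly
`u (n 0), u (n 1), …`, and the values coded at `u (n j)` by further reals `c i` lie in the `j`-th
target intervals. -/
theorem exists_code (hu : Function.Injective u) (hab : a < b)
    (hdense : ∀ x y, a ≤ x → x < y → y ≤ b → ∃ n, u n ∈ Ioo x y)
    (hd : ∀ n, 0 < d n) (hd0 : ∀ ε > 0, ∀ᶠ n in atTop, d n < ε)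
    (hg : ∀ n, ContinuousOn (g n) (Icc 0 (d n))) (himg : ∀ n, Icc 0 δ ⊆ g n '' Icc 0 (d n))
    {α β : ℕ → ι → ℝ} (hα : ∀ j i, 0 ≤ α j i) (hαβ : ∀ j i, α j i < β j i)
    (hβ : ∀ j i, β j i ≤ δ) :
    ∃ (n : ℕ → ℕ) (c₀ : ℝ) (c : ι → ℝ),
      (∀ e, IsLeftRecord u a c₀ e ↔ ∃ j, u (n j) = e) ∧
      ∀ j i, ∃ m ≤ n j, u m < c i ∧ c i < u m + d (n j) ∧
        g (n j) (c i - u m) ∈ Ioo (α j i) (β j i) := by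
  choose next idx hidx href using fun (s : Stage ι a b) (j : ℕ) =>
    Stage.exists_refines hdense hd hd0 hg himg (hα j) (hαβ j) (hβ j) s (j + 1)
  let s : ℕ → Stage ι a b := fun j => Nat.rec
    { p := a, q := b, l := fun _ => a, r := fun _ => b, le_p := le_rfl, p_lt_q := hab,
      q_le := le_rfl, le_l := fun _ => le_rfl, l_lt_r := fun _ => hab, r_le := fun _ => le_rfl }
    (fun j t => next t j) j
  let n : ℕ → ℕ := fun j => idx (s j) j
  have hs : ∀ j, Stage.Refines u d g (α j) (β j) (n j) (s j) (s (j + 1)) := fun j => href (s j) j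
  have hn : ∀ j, j < n j := fun j => hidx (s j) j
  obtain ⟨c₀, hc₀⟩ := exists_between_of_nested (p := fun j => (s j).p) (q := fun j => (s j).q)
    (fun j => (hs j).p_lt) (fun j => (hs j).q_lt) fun j => (s j).p_lt_q
  choose c hc using fun i => exists_between_of_nested (p := fun j => (s j).l i)
    (q := fun j => (s j).r i) (fun j => (hs j).l_lt i) (fun j => (hs j).r_lt i)
    fun j => (s j).l_lt_r i
  refine ⟨n, c₀, c, fun e => ⟨?_, ?_⟩, fun j i => ?_⟩
  · rintro ⟨⟨m, _, _, rfl, _⟩, ham, hmc, hrec⟩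
    -- Since `m < n m`, the term `u m` is not in `(p_m, q_{m+1})`, so some `p_k` is at or above it.
    have hex : ∃ k, u m ≤ (s k).p := by
      refine ⟨m, ?_⟩
      by_contra! hlt
      exact (hs m).first m (hn m) ⟨hlt, hmc.trans (hc₀ (m + 1)).2⟩
    have hfind := Nat.find_spec hex
    rcases hk : Nat.find hex with _ | k
    · rw [hk] at hfind
      exact absurd hfind ham.not_ge
    · rw [hk, (hs k).p_eq] at hfind
      have hlt : (s k).p < u m := not_le.1 (Nat.find_min hex (by omega))
      refine ⟨k, hfind.eq_or_lt.elim Eq.symm fun hlt' => ?_⟩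
      -- Otherwise `u (n k)` is an earlier and better approximation than `u m`.
      have hle : n k ≤ m := by
        by_contra! hmk
        exact (hs k).first m hmk ⟨hlt, hmc.trans (hc₀ (k + 1)).2⟩
      exact absurd ⟨u (n k), (precedes_iff hu).2 ⟨n k, hle, rfl⟩, hlt',
        (hs k).p_eq ▸ (hc₀ (k + 1)).1⟩ hrec
  · rintro ⟨j, rfl⟩
    have hp : u (n j) = (s (j + 1)).p := (hs j).p_eq.symm
    have hpj : (s j).p < u (n j) := hp ▸ (hs j).p_lt
    refine ⟨⟨_, _, le_rfl, rfl, rfl⟩, (s j).le_p.trans_lt hpj, hp ▸ (hc₀ (j + 1)).1, ?_⟩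
    rintro ⟨x, hx, hlt, hxc⟩
    obtain ⟨m, hm, rfl⟩ := (precedes_iff hu).1 hx
    have hne : m ≠ n j := fun h => by simp [h] at hlt
    exact (hs j).first m (lt_of_le_of_ne hm hne)
      ⟨hpj.trans hlt, hxc.trans (hc₀ (j + 1)).2⟩
  · obtain ⟨m, hm, hval⟩ := (hs j).value i
    exact ⟨m, hm, hval (c i) (hc i (j + 1))⟩

end Construction

end Coding

/-! ### Definability of compact sets -/

section Boxes

variable {k : ℕ} {δ : ℝ}

/-- The open box with lower corner `v (·, false)` and upper corner `v (·, true)`; it may be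
empty. -/
def openBox (v : Fin k × Bool → ℝ) : Set (Fin k → ℝ) :=
  {x | ∀ i, v (i, false) < x i ∧ x i < v (i, true)}

/-- A nonempty open subset of `(0, δ)^k` is a countable union of open boxes whose corners matter
only up to a positive error. -/
theorem exists_approximate_boxes {O : Set (Fin k → ℝ)} (hO : IsOpen O) (hne : O.Nonempty)
    (hOδ : ∀ x ∈ O, ∀ i, x i ∈ Ioo 0 δ) :
    ∃ α β : ℕ → Fin k × Bool → ℝ, (∀ j i, 0 ≤ α j i) ∧ (∀ j i, α j i < β j i) ∧
      (∀ j i, β j i ≤ δ) ∧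
      (∀ j v, (∀ i, v i ∈ Ioo (α j i) (β j i)) → openBox v ⊆ O) ∧
      ∀ x ∈ O, ∃ j, ∀ v, (∀ i, v i ∈ Ioo (α j i) (β j i)) → x ∈ openBox v := by
  let T : Set (Fin k × Bool → ℚ × ℚ) := {w |
    (∀ i, (0 : ℝ) ≤ (w i).1 ∧ ((w i).1 : ℝ) < (w i).2 ∧ ((w i).2 : ℝ) ≤ δ) ∧
      ∀ x : Fin k → ℝ, (∀ i, ((w (i, false)).1 : ℝ) < x i ∧ x i < (w (i, true)).2) → x ∈ O}
  have hT : ∀ x ∈ O, ∃ w ∈ T, ∀ i,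
      ((w (i, false)).2 : ℝ) ≤ x i ∧ x i ≤ (w (i, true)).1 := by
    intro x hx
    obtain ⟨ε, hε, hball⟩ := Metric.isOpen_iff.1 hO x hx
    have h1 : ∀ i, max 0 (x i - ε) < x i := fun i => max_lt (hOδ x hx i).1 (by linarith)
    have h2 : ∀ i, x i < min δ (x i + ε) := fun i => lt_min (hOδ x hx i).2 (by linarith)
    choose β hβ hβx using fun i => exists_rat_btwn (h1 i)
    choose α hα hαβ using fun i => exists_rat_btwn (hβ i)
    choose α' hα' hα'δ using fun i => exists_rat_btwn (h2 i)
    choose β' hβ' hβ'δ using fun i => exists_rat_btwn (hα'δ i)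
    refine ⟨fun i => cond i.2 (α' i.1, β' i.1) (α i.1, β i.1), ⟨?_, fun y hy => hball ?_⟩,
      fun i => ⟨(hβx i).le, (hα' i).le⟩⟩
    · have h0 := fun i => (le_max_left 0 (x i - ε)).trans_lt (hα i)
      have hδ := fun i => (hβ'δ i).trans_le (min_le_left δ (x i + ε))
      rintro ⟨i, _ | _⟩
      · refine ⟨(h0 i).le, hαβ i, ?_⟩
        have := hβx i; have := (hOδ x hx i).2
        simp only [cond_false]; linarith
      · refine ⟨?_, hβ' i, (hδ i).le⟩
        have := hα' i; have := (hOδ x hx i).1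
        simp only [cond_true]; linarith
    · rw [Metric.mem_ball, dist_pi_lt_iff hε]
      intro i
      obtain ⟨hy1, hy2⟩ := hy i
      simp only [cond_false, cond_true] at hy1 hy2
      have := (le_max_right 0 (x i - ε)).trans_lt (hα i)
      have := (hβ'δ i).trans_le (min_le_right δ (x i + ε))
      rw [Real.dist_eq, abs_lt]
      constructor <;> linarith
  obtain ⟨x₀, hx₀⟩ := hne
  obtain ⟨w₀, hw₀, -⟩ := hT x₀ hx₀
  obtain ⟨w, hw⟩ := (to_countable T).exists_eq_range ⟨w₀, hw₀⟩
  have hwT : ∀ j, w j ∈ T := fun j => hw ▸ mem_range_self j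
  refine ⟨fun j i => (w j i).1, fun j i => (w j i).2, fun j i => ((hwT j).1 i).1,
    fun j i => ((hwT j).1 i).2.1, fun j i => ((hwT j).1 i).2.2, fun j v hv x hx => ?_,
    fun x hx => ?_⟩
  · exact (hwT j).2 x fun i =>
      ⟨(hv (i, false)).1.trans (hx i).1, (hx i).2.trans (hv (i, true)).2⟩
  · obtain ⟨w', hw', hxw⟩ := hT x hx
    obtain ⟨j, rfl⟩ : w' ∈ range w := hw ▸ hw'
    exact ⟨j, fun v hv i => ⟨(hv (i, false)).2.trans_le (hxw i).1,
      (hxw i).2.trans_lt (hv (i, true)).1⟩⟩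

end Boxes

section Compact

variable {L : FirstOrder.Language.{u, v}} [L.Structure ℝ] {u : ℕ → ℝ} {E : Set ℝ}
  {h : ℝ → ℝ → ℝ} {a b δ : ℝ}

/-- The term of the enumeration used to read off a value is unique, because the scale does not
exceed the gaps between the relevant terms. -/
theorem isCodedValue_iff (hu : Function.Injective u) {n m : ℕ} {c d y : ℝ}
    (hd : IsScale u E (u n) d) (hm : m ≤ n) (hmc : u m < c) (hcm : c < u m + d) :
    IsCodedValue u E h c (u n) d y ↔ y = h d (c - u m) := by
  have hpm : Precedes u (u m) (u n) := (precedes_iff hu).2 ⟨m, hm, rfl⟩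
  constructor
  · rintro ⟨x, t, hx, hxc, hcx, ht, -, -, rfl⟩
    rcases lt_trichotomy x (u m) with hlt | rfl | hlt
    · linarith [hd.1.2.2 _ _ hx hpm hlt]
    · rw [← ht, add_sub_cancel_left]
    · linarith [hd.1.2.2 _ _ hpm hx hlt]
  · rintro rfl
    exact ⟨u m, c - u m, hpm, hmc, hcm, by ring, hd.1.1, ⟨by linarith, by linarith⟩, rfl⟩

/-- The open set coded by the reals `c₀` and `c i`: the union, over the left records `e` of `c₀`,
of the open boxes whose corners are the values coded at `e`. -/
def codedOpen {k : ℕ} (u : ℕ → ℝ) (E : Set ℝ) (h : ℝ → ℝ → ℝ) (a c₀ : ℝ)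
    (c : Fin k × Bool → ℝ) : Set (Fin k → ℝ) :=
  {x | ∃ e d, IsLeftRecord u a c₀ e ∧ IsScale u E e d ∧ ∀ i, ∃ y z,
    IsCodedValue u E h (c (i, false)) e d y ∧ IsCodedValue u E h (c (i, true)) e d z ∧
      y < x i ∧ x i < z}

theorem definablePred_codedOpen (φ : ordAdd →ᴸ L) [φ.IsExpansionOn ℝ]
    (hu : DefinablePred L fun v : Fin 2 → ℝ => Precedes u (v 0) (v 1)) (hE : E ⊆ Ioi 0)
    (hh : DefinablePred L fun v : Fin 3 → ℝ => FamilyGraph E h (v 0) (v 1) (v 2))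
    {k : ℕ} (c₀ : ℝ) (c : Fin k × Bool → ℝ) :
    DefinablePred L fun x => x ∈ codedOpen u E h a c₀ c := by
  refine DefinablePred.ex (DefinablePred.ex
    (((definablePred_isLeftRecord φ hu a c₀).comp₁ ?_).and
    (((definablePred_isScale φ hu (definablePred_mem_of_familyGraph hE hh)).comp₂ ?_ ?_).and
    (DefinablePred.forall_of_finite fun i => DefinablePred.ex (DefinablePred.ex
      (((definablePred_isCodedValue φ hu hh (c (i, false))).comp₃ ?_ ?_ ?_).and
      (((definablePred_isCodedValue φ hu hh (c (i, true))).comp₃ ?_ ?_ ?_).and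
      ((DefinablePred.lt φ ?_ ?_).and (DefinablePred.lt φ ?_ ?_))))))))) <;>
  exact definableFn_proj _

/-- Within the open cube `(0, δ)^k`, every open set is coded. -/
theorem exists_codedOpen_eq (hu : Function.Injective u) (hab : a < b)
    (hdense : ∀ x y, a ≤ x → x < y → y ≤ b → ∃ n, u n ∈ Ioo x y) (hpole : IsWeakPole L E h)
    (himg : ∀ d ∈ E, Icc 0 δ ⊆ h d '' Icc 0 d) {k : ℕ} {O : Set (Fin k → ℝ)} (hO : IsOpen O)
    (hne : O.Nonempty) (hOδ : ∀ x ∈ O, ∀ i, x i ∈ Ioo 0 δ) :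
    ∃ (c₀ : ℝ) (c : Fin k × Bool → ℝ), codedOpen u E h a c₀ c = O := by
  obtain ⟨α, β, hα, hαβ, hβ, hsub, hcov⟩ := exists_approximate_boxes hO hne hOδ
  choose d hd using exists_isScale hu hpole.pos hpole.closed hpole.accumulates
  obtain ⟨n, c₀, c, hrec, hval⟩ := exists_code (g := fun n => h (d n)) hu hab hdense
    (fun n => hpole.pos (hd n).1.1) (fun ε hε => eventually_scale_lt hu hab hdense hd hε)
    (fun n => hpole.continuousOn _ (hd n).1.1) (fun n => himg _ (hd n).1.1) hα hαβ hβ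
  choose m hm hmc hcm hmem using hval
  have hcoded : ∀ j i y, IsCodedValue u E h (c i) (u (n j)) (d (n j)) y ↔
      y = h (d (n j)) (c i - u (m j i)) := fun j i y =>
    isCodedValue_iff hu (hd _) (hm j i) (hmc j i) (hcm j i)
  have key : ∀ x, x ∈ codedOpen u E h a c₀ c ↔
      ∃ j, x ∈ openBox fun i => h (d (n j)) (c i - u (m j i)) := by
    intro x
    constructor
    · rintro ⟨e, d', he, hd', hx⟩
      obtain ⟨j, rfl⟩ := (hrec e).1 he
      obtain rfl := hd'.unique (hd _)
      refine ⟨j, fun i => ?_⟩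
      obtain ⟨y, z, hy, hz, hyx, hxz⟩ := hx i
      rw [hcoded] at hy hz
      exact ⟨hy.symm.trans_lt hyx, hxz.trans_eq hz⟩
    · rintro ⟨j, hx⟩
      exact ⟨u (n j), d (n j), (hrec _).2 ⟨j, rfl⟩, hd _, fun i =>
        ⟨_, _, (hcoded _ _ _).2 rfl, (hcoded _ _ _).2 rfl, hx i⟩⟩
  refine ⟨c₀, c, Set.ext fun x => (key x).trans ⟨?_, fun hx => ?_⟩⟩
  · rintro ⟨j, hx⟩
    exact hsub j _ (hmem j) hx
  · obtain ⟨j, hj⟩ := hcov x hx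
    exact ⟨j, hj _ (hmem j)⟩

theorem def_of_isClosed_of_subset_cube (φ : ordAdd →ᴸ L) [φ.IsExpansionOn ℝ]
    (hprec : DefinablePred L fun v : Fin 2 → ℝ => Precedes u (v 0) (v 1))
    (hu : Function.Injective u) (hab : a < b)
    (hdense : ∀ x y, a ≤ x → x < y → y ≤ b → ∃ n, u n ∈ Ioo x y) (hpole : IsWeakPole L E h)
    (himg : ∀ d ∈ E, Icc 0 δ ⊆ h d '' Icc 0 d) {k : ℕ} {K : Set (Fin k → ℝ)} (hK : IsClosed K)
    (hKδ : ∀ x ∈ K, ∀ i, x i ∈ Ioo 0 δ) : Def L K := by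
  have hcube : DefinablePred L fun x : Fin k → ℝ => ∀ i, 0 < x i ∧ x i < δ :=
    DefinablePred.forall_of_finite fun i =>
      (DefinablePred.lt φ (definableFn_const 0) (definableFn_proj i)).and
        (DefinablePred.lt φ (definableFn_proj i) (definableFn_const δ))
  have hopen : IsOpen {x : Fin k → ℝ | ∀ i, 0 < x i ∧ x i < δ} := by
    simp only [ofPred_forall]
    exact isOpen_iInter_of_finite fun i =>
      (isOpen_lt continuous_const (continuous_apply i)).inter
        (isOpen_lt (continuous_apply i) continuous_const)
  rcases ({x : Fin k → ℝ | ∀ i, 0 < x i ∧ x i < δ} \ K).eq_empty_or_nonempty with hempty | hne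
  · have : K = {x : Fin k → ℝ | ∀ i, 0 < x i ∧ x i < δ} :=
      Subset.antisymm hKδ (sdiff_eq_empty.1 hempty)
    exact this ▸ hcube
  · obtain ⟨c₀, c, hc⟩ := exists_codedOpen_eq hu hab hdense hpole himg
      (hopen.sdiff hK) hne fun x hx => hx.1
    have hdef := hcube.and
      (definablePred_codedOpen (a := a) φ hprec hpole.pos hpole.definable c₀ c).not
    have heq : K = {x : Fin k → ℝ | (∀ i, 0 < x i ∧ x i < δ) ∧ x ∉ codedOpen u E h a c₀ c} := by
      ext x
      rw [mem_ofPred_eq, hc]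
      constructor
      · exact fun hx => ⟨hKδ x hx, fun hx' => hx'.2 hx⟩
      · rintro ⟨h1, h2⟩
        by_contra hx
        exact h2 ⟨h1, hx⟩
    exact heq ▸ hdef

/-- Translation and repeated doubling carry definability from compact subsets of a small cube to
all compact sets. -/
theorem def_of_isCompact (φ : ordAdd →ᴸ L) [φ.IsExpansionOn ℝ] {k : ℕ} (hδ : 0 < δ)
    (hsmall : ∀ K : Set (Fin k → ℝ), IsClosed K → (∀ x ∈ K, ∀ i, x i ∈ Ioo 0 δ) → Def L K)
    {K : Set (Fin k → ℝ)} (hK : IsCompact K) : Def L K := by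
  have key : ∀ N : ℕ, ∀ K : Set (Fin k → ℝ), IsClosed K →
      (∀ x ∈ K, ∀ i, |x i| < 2 ^ N * (δ / 2)) → Def L K := by
    intro N
    induction N with
    | zero =>
      intro K hK hKN
      have hdef : DefinablePred L fun x =>
          x ∈ (fun x : Fin k → ℝ => fun i => x i + -(δ / 2)) ⁻¹' K :=
        hsmall _ (hK.preimage (by fun_prop)) fun x hx i => by
          have := abs_lt.1 (hKN _ hx i)
          constructor <;> linarith [this.1, this.2]
      have := hdef.comp (F := fun (x : Fin k → ℝ) i => x i + δ / 2) fun i =>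
        definableFn_add φ (definableFn_proj i) (definableFn_const _)
      have hK' : DefinablePred L fun x => x ∈ K := by simpa using this
      exact hK'
    | succ N ih =>
      intro K hK hKN
      have hdef : DefinablePred L fun x =>
          x ∈ (fun x : Fin k → ℝ => fun i => x i + x i) ⁻¹' K :=
        ih _ (hK.preimage (by fun_prop)) fun x hx i => by
          have := hKN _ hx i
          simp only [← two_mul, abs_mul, abs_two, pow_succ] at this
          linarith
      have hhalf : ∀ i : Fin k, DefinableFn L fun x : Fin k → ℝ => x i / 2 := by
        intro i
        have := DefinablePred.eq (L := L) (definableFn_add φ (α := Option (Fin k))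
          (definableFn_proj none) (definableFn_proj none)) (definableFn_proj (some i))
        refine (congrArg (Definable univ L) ?_).mpr this
        ext v
        simp only [Function.tupleGraph, mem_ofPred_eq, Function.comp_apply]
        constructor <;> intro h <;> linarith
      have := hdef.comp (F := fun (x : Fin k → ℝ) i => x i / 2) hhalf
      have hK' : DefinablePred L fun x => x ∈ K := by simpa using this
      exact hK'
  obtain ⟨R, hR⟩ := hK.isBounded.exists_norm_le
  obtain ⟨N, hN⟩ := pow_unbounded_of_one_lt (R / (δ / 2)) one_lt_two
  refine key N K hK.isClosed fun x hx i => ?_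
  rw [div_lt_iff₀ (by positivity)] at hN
  exact (norm_le_pi_norm x i).trans_lt ((hR x hx).trans_lt hN)

/-- A dense `ω`-orderable set is infinite, hence is enumerated without repetition along its
definable order. -/
theorem exists_enumeration (hD : DefinesDenseOmegaOrderable L) :
    ∃ (u : ℕ → ℝ) (a b : ℝ), Function.Injective u ∧ a < b ∧
      (∀ x y, a ≤ x → x < y → y ≤ b → ∃ n, u n ∈ Ioo x y) ∧
      DefinablePred L fun v : Fin 2 → ℝ => Precedes u (v 0) (v 1) := by
  obtain ⟨D, ⟨hdef, hD⟩, a, b, hab, hdense⟩ := hD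
  rcases hD with hfin | ⟨r, hr, ⟨f⟩⟩
  · rw [hfin.isClosed.closure_eq] at hdense
    exact absurd (hfin.subset hdense) (Ioo_infinite hab)
  refine ⟨fun n => f.symm n, a, b, Subtype.val_injective.comp f.symm.injective, hab, ?_, ?_⟩
  · intro x y hx hxy hy
    obtain ⟨z, hz⟩ := exists_between hxy
    obtain ⟨w, hw, hwD⟩ := mem_closure_iff.1 (hdense ⟨hx.trans_lt hz.1, hz.2.trans_le hy⟩)
      (Ioo x y) isOpen_Ioo hz
    exact ⟨f ⟨w, hwD⟩, by simpa using hw⟩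
  · have hd : DefinablePred L fun v : Fin 1 → ℝ => v 0 ∈ D := hdef
    have hr' : DefinablePred L fun v : Fin 2 → ℝ => v 0 ∈ D ∧ v 1 ∈ D ∧ r (v 0) (v 1) := hr
    have hdef' : DefinablePred L fun v : Fin 2 → ℝ =>
        ¬ (¬ (v 0 ∈ D ∧ v 1 ∈ D ∧ r (v 0) (v 1)) ∧ ¬ (v 0 ∈ D ∧ v 0 = v 1)) :=
      (hr'.not.and ((hd.comp₁ (R := (· ∈ D)) (definableFn_proj 0)).and
        (DefinablePred.eq (definableFn_proj 0) (definableFn_proj 1))).not).not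
    have hiff : ∀ x y, Precedes (fun n => (f.symm n : ℝ)) x y ↔
        ¬ (¬ (x ∈ D ∧ y ∈ D ∧ r x y) ∧ ¬ (x ∈ D ∧ x = y)) := by
      intro x y
      rw [← not_or, not_not]
      constructor
      · rintro ⟨m, n, hmn, rfl, rfl⟩
        rcases hmn.lt_or_eq with hlt | rfl
        · exact Or.inl ⟨(f.symm m).2, (f.symm n).2, f.symm.map_rel_iff.2 hlt⟩
        · exact Or.inr ⟨(f.symm m).2, rfl⟩
      · rintro (⟨hx, hy, hxy⟩ | ⟨hx, rfl⟩)
        · refine ⟨f ⟨x, hx⟩, f ⟨y, hy⟩, le_of_lt (f.map_rel_iff.2 ?_), by simp, by simp⟩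
          exact hxy
        · exact ⟨f ⟨x, hx⟩, f ⟨x, hx⟩, le_rfl, by simp, by simp⟩
    simpa only [hiff] using hdef'

end Compact

end WeakPoles

theorem mainTheorem9 (L : FirstOrder.Language.{u, v}) [L.Structure ℝ]
    (φ : WeakPoles.ordAdd →ᴸ L) [φ.IsExpansionOn ℝ]
    (hB : WeakPoles.IsTypeB L) :
    ¬ WeakPoles.DefinesWeakPole L := by
  rintro ⟨E, h, hpole⟩
  obtain ⟨hD, k, K, hK, hndef⟩ := hB
  obtain ⟨u, a, b, hu, hab, hdense, hprec⟩ := WeakPoles.exists_enumeration hD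
  obtain ⟨δ, hδ, himg⟩ := hpole.image
  exact hndef (WeakPoles.def_of_isCompact φ hδ (fun _ hC hCδ =>
    WeakPoles.def_of_isClosed_of_subset_cube φ hprec hu hab hdense hpole himg hC hCδ) hK)
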